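/- Let $a, b$ be integers with $0 < a < b$. Then the equation $E'_{a,b} : y^2 = x^3 - a^2x + b^6$ defines an elliptic curve over $\mathbb{Q}$, and the Mordell–Weil rank of $E'_{a,b}$ over $\mathbb{Q}$ (the rank of the abelian group $E'_{a,b}(\mathbb{Q})$) is at least $3$. More precisely, $(0, b^3)$, $(a, b^3)$ and $(-b^2, ab)$ are rational points of $E'_{a,b}$ that are $\mathbb{Z}$-linearly independent in $E'_{a,b}(\mathbb{Q})$. -/

import Mathlib

/-- The Weierstrass curve `y² = x³ - a² x + b⁶` over `ℚ`. -/
def curveE' (a b : ℤ) : WeierstrassCurve ℚ where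
  a₁ := 0
  a₂ := 0
  a₃ := 0
  a₄ := -(a : ℚ) ^ 2
  a₆ := (b : ℚ) ^ 6

/-- The Mordell–Weil rank of a Weierstrass curve over `ℚ`: the rank of the abelian group `W(ℚ)`
of rational points (with the point at infinity as zero), that is, the supremum of the
cardinalities of `ℤ`-linearly independent families of rational points. It is a cardinal, so that
no junk value can occur. For `W(ℚ) ≃ ℤʳ ⊕ torsion` it is `r`. -/
noncomputable def mordellWeilRank (W : WeierstrassCurve ℚ) : Cardinal :=
  Module.rank ℤ (WeierstrassCurve.Affine.Point W.toAffine)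

/-!
Write `P = (0, b³)`, `Q = (a, b³)`, `R = (-b², ab)` and `τ = a / b²`. Since the curve has no rational
`2`-torsion, infinite descent reduces independence to showing that in every relation
`nP + mQ + lR = 0` all three coefficients are even.

The tool is `p`-adic. For a short Weierstrass curve with `|a₄|ₚ ≤ C²` and `|a₆|ₚ ≤ C³`, the points
with `|x|ₚ > C` form, with the point at infinity, a subgroup (`nearInfinity`); this is proved directly
from the formulas for the sum and the product of `x(P + Q)` and `x(P - Q)`.

As `0 < a < b`, the number `τ` is not an integer, so `|a|ₚ > |b|ₚ²` for some prime `p`. For `C = |a|ₚ`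
the subgroup contains `2P`, `2Q` and `P - R`, but none of `P`, `Q`, `P + Q`. Hence `n + l` and `m` are
even in every relation (`even_and_even_of_relation`).

If `l` were odd, `P - R` would be a combination of `2P`, `2Q` and `2(P - R)`, in particular the double
of a rational point. The equation for its halves, linear in `τ`, shows that `|τ|₂ > 1`
(`one_lt_padicNorm_two_of_sub_eq_add_self`). But then the subgroup at `p = 2` with threshold
`C = |x(P - R)|₂` contains `2P`, `2Q` and `2(P - R)` and not `P - R` (`sub_ne_double`): at the prime
two, doubling moves a point strictly closer to infinity.
-/

/-! ### The group law on short Weierstrass curves over `ℚ` -/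

namespace WeierstrassCurve.Affine.Point

variable {W : WeierstrassCurve ℚ} [W.IsShortNF]

lemma equation_of_nonsingular {x y : ℚ} (h : W.toAffine.Nonsingular x y) :
    y ^ 2 = x ^ 3 + W.a₄ * x + W.a₆ := by
  have := (equation_iff ..).mp h.1
  simpa using this

lemma exists_some_add_some {x₁ y₁ x₂ y₂ : ℚ} (h₁ : W.toAffine.Nonsingular x₁ y₁)
    (h₂ : W.toAffine.Nonsingular x₂ y₂) (hx : x₁ ≠ x₂) :
    ∃ s : ℚ, s * (x₁ - x₂) = y₁ - y₂ ∧
      ∃ h : W.toAffine.Nonsingular (s ^ 2 - x₁ - x₂) (s * (2 * x₁ + x₂ - s ^ 2) - y₁),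
        some x₁ y₁ h₁ + some x₂ y₂ h₂ = some _ _ h := by
  refine ⟨(y₁ - y₂) / (x₁ - x₂), div_mul_cancel₀ _ (sub_ne_zero.mpr hx), ?_⟩
  have key := add_of_X_ne (h₁ := h₁) (h₂ := h₂) hx
  have hs := slope_of_X_ne (W := W.toAffine) (y₁ := y₁) (y₂ := y₂) hx
  have e₁ : W.toAffine.addX x₁ x₂ (W.toAffine.slope x₁ x₂ y₁ y₂) =
      ((y₁ - y₂) / (x₁ - x₂)) ^ 2 - x₁ - x₂ := by
    rw [hs]; simp
  have e₂ : W.toAffine.addY x₁ x₂ y₁ (W.toAffine.slope x₁ x₂ y₁ y₂) =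
      (y₁ - y₂) / (x₁ - x₂) * (2 * x₁ + x₂ - ((y₁ - y₂) / (x₁ - x₂)) ^ 2) - y₁ := by
    rw [hs]; simp [addY, negY]; ring
  have h := nonsingular_add h₁ h₂ (fun hxy => hx hxy.1)
  rw [e₁, e₂] at h
  refine ⟨h, ?_⟩
  rw [key, some.injEq]
  exact ⟨e₁, e₂⟩

lemma exists_some_add_self {x y : ℚ} (h : W.toAffine.Nonsingular x y) (hy : y ≠ 0) :
    ∃ s : ℚ, s * (2 * y) = 3 * x ^ 2 + W.a₄ ∧
      ∃ h' : W.toAffine.Nonsingular (s ^ 2 - 2 * x) (s * (3 * x - s ^ 2) - y),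
        some x y h + some x y h = some _ _ h' := by
  refine ⟨(3 * x ^ 2 + W.a₄) / (2 * y), div_mul_cancel₀ _ (by simpa using hy), ?_⟩
  have hy' : y ≠ W.toAffine.negY x y := by
    simp only [negY, a₁_of_isShortNF, a₃_of_isShortNF]
    intro h0
    exact hy (by linarith)
  have key := add_self_of_Y_ne (h₁ := h) hy'
  have hs : W.toAffine.slope x x y y = (3 * x ^ 2 + W.a₄) / (2 * y) := by
    rw [slope_of_Y_ne rfl hy']
    simp [negY]
    ring_nf
  have e₁ : W.toAffine.addX x x (W.toAffine.slope x x y y) =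
      ((3 * x ^ 2 + W.a₄) / (2 * y)) ^ 2 - 2 * x := by
    rw [hs]; simp; ring
  have e₂ : W.toAffine.addY x x y (W.toAffine.slope x x y y) =
      (3 * x ^ 2 + W.a₄) / (2 * y) * (3 * x - ((3 * x ^ 2 + W.a₄) / (2 * y)) ^ 2) - y := by
    rw [hs]; simp [addY, negY]; ring
  have h' := nonsingular_add h h (fun hxy => hy' hxy.2)
  rw [e₁, e₂] at h'
  refine ⟨h', ?_⟩
  rw [key, some.injEq]
  exact ⟨e₁, e₂⟩

lemma some_add_self_of_y_eq_zero {x y : ℚ} (h : W.toAffine.Nonsingular x y) (hy : y = 0) :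
    some x y h + some x y h = 0 :=
  add_self_of_Y_eq (by simp [negY, hy])

lemma some_neg {x y : ℚ} (h : W.toAffine.Nonsingular x y) :
    ∃ h' : W.toAffine.Nonsingular x (-y), -some x y h = some x (-y) h' := by
  have e : W.toAffine.negY x y = -y := by simp [negY]
  have h' := (nonsingular_neg x y).mpr h
  rw [e] at h'
  refine ⟨h', ?_⟩
  rw [neg_some, some.injEq]
  exact ⟨rfl, e⟩

end WeierstrassCurve.Affine.Point

/-! ### Ultrametric arithmetic -/

namespace padicNorm

variable {p : ℕ} [Fact p.Prime]

lemma add_eq_left_of_lt {q r : ℚ} (h : padicNorm p r < padicNorm p q) :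
    padicNorm p (q + r) = padicNorm p q := by
  rw [padicNorm.add_eq_max_of_ne h.ne', max_eq_left h.le]

lemma add_lt_of_lt {q r c : ℚ} (hq : padicNorm p q < c) (hr : padicNorm p r < c) :
    padicNorm p (q + r) < c :=
  padicNorm.nonarchimedean.trans_lt (max_lt hq hr)

lemma add_le_of_le {q r c : ℚ} (hq : padicNorm p q ≤ c) (hr : padicNorm p r ≤ c) :
    padicNorm p (q + r) ≤ c :=
  padicNorm.nonarchimedean.trans (max_le hq hr)

lemma intCast_mul_le (n : ℤ) (q : ℚ) : padicNorm p (n * q) ≤ padicNorm p q := by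
  rw [padicNorm.mul]
  exact mul_le_of_le_one_left (padicNorm.nonneg q) (padicNorm.of_int n)

protected lemma pow (q : ℚ) (n : ℕ) : padicNorm p (q ^ n) = padicNorm p q ^ n := by
  induction n with
  | zero => simp
  | succ n ih => rw [pow_succ, padicNorm.mul, ih, pow_succ]

end padicNorm

/-! ### Points near infinity -/

namespace WeierstrassCurve.Affine.Point

variable {p : ℕ} [Fact p.Prime]

/-- If the product and the sum of two rational numbers `u`, `v` have the `p`-adic sizes that
`x(P + Q)` and `x(P - Q)` have for points near infinity, then neither of them is small: a small `u`
would force `v` to dominate the sum. -/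
lemma le_padicNorm_of_prod_of_sum {u v d m M : ℚ} (hm : 0 < m) (hmM : m ≤ M)
    (hd : padicNorm p d ≤ M ^ 2) (hprod : padicNorm p (u * v * d) = (m * M) ^ 2)
    (hsum : padicNorm p ((v + u) * d) ≤ m * M ^ 2) : m ≤ padicNorm p u := by
  by_contra! hlt
  have hM : 0 < M := hm.trans_le hmM
  rw [padicNorm.mul, padicNorm.mul] at hprod
  rw [padicNorm.mul] at hsum
  have hU := padicNorm.nonneg (p := p) u
  have hV := padicNorm.nonneg (p := p) v
  have hD := padicNorm.nonneg (p := p) d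
  have hVd : 0 < padicNorm p v * padicNorm p d := by
    refine lt_of_le_of_ne (mul_nonneg hV hD) fun h0 => ?_
    rw [mul_assoc, ← h0, mul_zero] at hprod
    exact (by positivity : (m * M) ^ 2 ≠ 0) hprod.symm
  have big : m * M ^ 2 < padicNorm p v * padicNorm p d := by
    refine lt_of_mul_lt_mul_left ?_ hm.le
    calc m * (m * M ^ 2) = padicNorm p u * (padicNorm p v * padicNorm p d) := by linarith
      _ < m * (padicNorm p v * padicNorm p d) := mul_lt_mul_of_pos_right hlt hVd
  have hmV : m < padicNorm p v := by
    by_contra! h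
    exact absurd (mul_le_mul h hd hD hm.le) (not_le.mpr big)
  rw [padicNorm.add_eq_left_of_lt (hlt.trans hmV)] at hsum
  exact absurd hsum (not_le.mpr big)

/-- The sum and the product of `x(P + Q)` and `x(P - Q)` are rational functions of `x(P)` and
`x(Q)` alone. -/
lemma sum_and_prod_of_slopes {A B x₁ y₁ x₂ y₂ s t : ℚ}
    (e₁ : y₁ ^ 2 = x₁ ^ 3 + A * x₁ + B) (e₂ : y₂ ^ 2 = x₂ ^ 3 + A * x₂ + B)
    (hx : x₁ ≠ x₂) (hs : s * (x₁ - x₂) = y₁ - y₂) (ht : t * (x₁ - x₂) = y₁ + y₂) :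
    ((t ^ 2 - x₁ - x₂) + (s ^ 2 - x₁ - x₂)) * (x₁ - x₂) ^ 2 =
        (2 : ℤ) * (x₁ * x₂ * x₁ + x₁ * x₂ * x₂ + A * x₁ + A * x₂) + (4 : ℤ) * B ∧
      (s ^ 2 - x₁ - x₂) * (t ^ 2 - x₁ - x₂) * (x₁ - x₂) ^ 2 =
        (x₁ * x₂ - A) ^ 2 + (-4 : ℤ) * (B * (x₁ + x₂)) := by
  have hu : (s ^ 2 - x₁ - x₂) * (x₁ - x₂) ^ 2 =
      (y₁ - y₂) ^ 2 - (x₁ + x₂) * (x₁ - x₂) ^ 2 := by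
    rw [← hs]; ring
  have hv : (t ^ 2 - x₁ - x₂) * (x₁ - x₂) ^ 2 =
      (y₁ + y₂) ^ 2 - (x₁ + x₂) * (x₁ - x₂) ^ 2 := by
    rw [← ht]; ring
  push_cast
  refine ⟨by linear_combination hu + hv + 2 * e₁ + 2 * e₂, ?_⟩
  refine mul_right_cancel₀ (pow_ne_zero 2 (sub_ne_zero.mpr hx)) ?_
  have e₃ : y₁ ^ 2 - y₂ ^ 2 = (x₁ - x₂) * (x₁ ^ 2 + x₁ * x₂ + x₂ ^ 2 + A) := by
    linear_combination e₁ - e₂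
  have : (s ^ 2 - x₁ - x₂) * (t ^ 2 - x₁ - x₂) * (x₁ - x₂) ^ 2 * (x₁ - x₂) ^ 2 =
      (y₁ ^ 2 - y₂ ^ 2) ^ 2 - (x₁ + x₂) * (x₁ - x₂) ^ 2 * (2 * (y₁ ^ 2 + y₂ ^ 2)) +
        ((x₁ + x₂) * (x₁ - x₂) ^ 2) ^ 2 := by
    rw [show (s ^ 2 - x₁ - x₂) * (t ^ 2 - x₁ - x₂) * (x₁ - x₂) ^ 2 * (x₁ - x₂) ^ 2 =
      ((s ^ 2 - x₁ - x₂) * (x₁ - x₂) ^ 2) * ((t ^ 2 - x₁ - x₂) * (x₁ - x₂) ^ 2) by ring, hu, hv]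
    ring
  rw [this, e₃, e₁, e₂]
  ring

lemma min_padicNorm_le_of_add {A B C x₁ y₁ x₂ y₂ s : ℚ}
    (hA : padicNorm p A ≤ C ^ 2) (hB : padicNorm p B ≤ C ^ 3) (hC : 0 ≤ C)
    (e₁ : y₁ ^ 2 = x₁ ^ 3 + A * x₁ + B) (e₂ : y₂ ^ 2 = x₂ ^ 3 + A * x₂ + B)
    (hx : x₁ ≠ x₂) (hs : s * (x₁ - x₂) = y₁ - y₂)
    (h₁ : C < padicNorm p x₁) (h₂ : C < padicNorm p x₂) :
    min (padicNorm p x₁) (padicNorm p x₂) ≤ padicNorm p (s ^ 2 - x₁ - x₂) := by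
  obtain ⟨t, ht⟩ : ∃ t : ℚ, t * (x₁ - x₂) = y₁ + y₂ :=
    ⟨_, div_mul_cancel₀ _ (sub_ne_zero.mpr hx)⟩
  obtain ⟨hsum, hprod⟩ := sum_and_prod_of_slopes e₁ e₂ hx hs ht
  obtain ⟨m, hm⟩ : ∃ m, m = min (padicNorm p x₁) (padicNorm p x₂) := ⟨_, rfl⟩
  obtain ⟨M, hM⟩ : ∃ M, M = max (padicNorm p x₁) (padicNorm p x₂) := ⟨_, rfl⟩
  have hxx : padicNorm p (x₁ * x₂) = m * M := by
    rw [hm, hM, min_mul_max, padicNorm.mul]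
  have hCm : C < m := hm ▸ lt_min h₁ h₂
  have hmM : m ≤ M := hm ▸ hM ▸ min_le_max
  have hXM : padicNorm p x₁ ≤ M := hM ▸ le_max_left ..
  have hYM : padicNorm p x₂ ≤ M := hM ▸ le_max_right ..
  have hm0 : 0 < m := hC.trans_lt hCm
  have hM0 : 0 < M := hm0.trans_le hmM
  have hA' : padicNorm p A < m ^ 2 := hA.trans_lt (pow_lt_pow_left₀ hCm hC (by norm_num))
  have hB' : padicNorm p B < m ^ 3 := hB.trans_lt (pow_lt_pow_left₀ hCm hC (by norm_num))
  have hmm : m ^ 2 ≤ m * M := by rw [sq]; exact mul_le_mul_of_nonneg_left hmM hm0.le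
  rw [← hm]
  refine le_padicNorm_of_prod_of_sum (v := t ^ 2 - x₁ - x₂) (d := (x₁ - x₂) ^ 2) hm0 hmM ?_ ?_ ?_
  · rw [padicNorm.pow]
    exact pow_le_pow_left₀ (padicNorm.nonneg _) (hM ▸ padicNorm.sub) 2
  · have n₁ : padicNorm p (x₁ * x₂ - A) = m * M := by
      rw [sub_eq_add_neg, padicNorm.add_eq_left_of_lt, hxx]
      rw [padicNorm.neg, hxx]
      exact hA'.trans_le hmm
    rw [hprod, padicNorm.add_eq_left_of_lt, padicNorm.pow, n₁]
    rw [padicNorm.pow, n₁]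
    refine (padicNorm.intCast_mul_le _ _).trans_lt ?_
    rw [padicNorm.mul]
    have hxM : padicNorm p (x₁ + x₂) ≤ M := padicNorm.add_le_of_le hXM hYM
    calc padicNorm p B * padicNorm p (x₁ + x₂)
        ≤ padicNorm p B * M := mul_le_mul_of_nonneg_left hxM (padicNorm.nonneg _)
      _ < m ^ 3 * M := mul_lt_mul_of_pos_right hB' hM0
      _ = m ^ 2 * (m * M) := by ring
      _ ≤ m * M * (m * M) := mul_le_mul_of_nonneg_right hmm (mul_pos hm0 hM0).le
      _ = (m * M) ^ 2 := by ring
  · have hxxx : ∀ x, padicNorm p x ≤ M → padicNorm p (x₁ * x₂ * x) ≤ m * M ^ 2 := fun x hx => by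
      rw [padicNorm.mul, hxx, sq, ← mul_assoc]
      exact mul_le_mul_of_nonneg_left hx (mul_pos hm0 hM0).le
    have hAx : ∀ x, padicNorm p x ≤ M → padicNorm p (A * x) ≤ m * M ^ 2 := fun x hx => by
      rw [padicNorm.mul, sq, ← mul_assoc]
      exact mul_le_mul (hA'.le.trans hmm) hx (padicNorm.nonneg _) (mul_pos hm0 hM0).le
    rw [hsum]
    refine padicNorm.add_le_of_le ((padicNorm.intCast_mul_le _ _).trans ?_)
      ((padicNorm.intCast_mul_le _ _).trans ?_)
    · exact padicNorm.add_le_of_le (padicNorm.add_le_of_le (padicNorm.add_le_of_le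
        (hxxx _ hXM) (hxxx _ hYM)) (hAx _ hXM)) (hAx _ hYM)
    · refine hB'.le.trans ?_
      rw [pow_succ' m 2]
      exact mul_le_mul_of_nonneg_left (pow_le_pow_left₀ hm0.le hmM 2) hm0.le

/-- Doubling near infinity: `x(2P)` has the `p`-adic size of `x(P) / 4`. -/
lemma padicNorm_four_mul_of_add_self {A B C x y s : ℚ}
    (hA : padicNorm p A ≤ C ^ 2) (hB : padicNorm p B ≤ C ^ 3) (hC : 0 ≤ C)
    (e : y ^ 2 = x ^ 3 + A * x + B) (hs : s * (2 * y) = 3 * x ^ 2 + A)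
    (h : C < padicNorm p x) :
    padicNorm p (4 * (s ^ 2 - 2 * x)) = padicNorm p x := by
  have key : 4 * (s ^ 2 - 2 * x) * (x ^ 3 + (A * x + B)) =
      (x ^ 2 - A) ^ 2 + (-8 : ℤ) * (B * x) := by
    have h4 : s ^ 2 * (4 * y ^ 2) = (3 * x ^ 2 + A) ^ 2 := by rw [← hs]; ring
    push_cast
    rw [e] at h4
    linear_combination h4
  set X := padicNorm p x with hX
  have hX0 : 0 < X := hC.trans_lt h
  have hC2 : C ^ 2 < X ^ 2 := pow_lt_pow_left₀ h hC (by norm_num)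
  have hC3 : C ^ 3 < X ^ 3 := pow_lt_pow_left₀ h hC (by norm_num)
  have n₁ : padicNorm p (x ^ 3 + (A * x + B)) = X ^ 3 := by
    rw [padicNorm.add_eq_left_of_lt, padicNorm.pow]
    rw [padicNorm.pow]
    refine padicNorm.add_lt_of_lt ?_ (hB.trans_lt hC3)
    rw [padicNorm.mul, ← hX]
    nlinarith
  have n₂ : padicNorm p (x ^ 2 - A) = X ^ 2 := by
    rw [sub_eq_add_neg, padicNorm.add_eq_left_of_lt, padicNorm.pow]
    rw [padicNorm.neg, padicNorm.pow]
    exact hA.trans_lt hC2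
  have n₃ : padicNorm p ((x ^ 2 - A) ^ 2 + (-8 : ℤ) * (B * x)) = X ^ 4 := by
    rw [padicNorm.add_eq_left_of_lt, padicNorm.pow, n₂]
    · ring
    · rw [padicNorm.pow, n₂]
      refine (padicNorm.intCast_mul_le _ _).trans_lt ?_
      rw [padicNorm.mul, ← hX]
      nlinarith
  rw [← key, padicNorm.mul, n₁] at n₃
  refine mul_right_cancel₀ (pow_pos hX0 3).ne' (n₃.trans (by ring))

/-- The points of a short Weierstrass curve over `ℚ` that are `p`-adically close to the point at
infinity: those with `|x|ₚ > C`, together with the point at infinity itself. If `|a₄|ₚ ≤ C²` and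
`|a₆|ₚ ≤ C³` this is a subgroup (after rescaling, a piece of the filtration of the kernel of
reduction); the case `p = 2` is included. -/
def nearInfinity (W : WeierstrassCurve ℚ) [W.IsShortNF] (p : ℕ) [Fact p.Prime] (C : ℚ)
    (hC : 0 ≤ C) (hA : padicNorm p W.a₄ ≤ C ^ 2) (hB : padicNorm p W.a₆ ≤ C ^ 3) :
    AddSubgroup W.toAffine.Point where
  carrier := {P | ∀ x y h, P = some x y h → C < padicNorm p x}
  zero_mem' := fun _ _ h h0 => absurd h0.symm (some_ne_zero h)
  neg_mem' := by
    rintro (_ | ⟨x₁, y₁, h₁⟩) hP x y h heq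
    · exact absurd heq.symm (some_ne_zero h)
    · obtain ⟨h', e⟩ := some_neg h₁
      rw [e, some.injEq] at heq
      rw [← heq.1]
      exact hP _ _ h₁ rfl
  add_mem' := by
    rintro (_ | ⟨x₁, y₁, h₁⟩) (_ | ⟨x₂, y₂, h₂⟩) hP hQ x y h heq
    · exact absurd heq.symm (some_ne_zero h)
    · exact hQ x y h (by rw [← heq]; exact (zero_add _).symm)
    · exact hP x y h (by rw [← heq]; exact (add_zero _).symm)
    · have hX := hP _ _ h₁ rfl
      have hY := hQ _ _ h₂ rfl
      by_cases hx : x₁ = x₂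
      · rcases X_eq_iff.mp hx with e | e
        · rw [← e] at heq
          by_cases hy : y₁ = 0
          · rw [some_add_self_of_y_eq_zero h₁ hy] at heq
            exact absurd heq.symm (some_ne_zero h)
          · obtain ⟨s, hs, h', e'⟩ := exists_some_add_self h₁ hy
            rw [e', some.injEq] at heq
            have := padicNorm_four_mul_of_add_self hA hB hC (equation_of_nonsingular h₁) hs hX
            have h4 := padicNorm.intCast_mul_le (p := p) 4 (s ^ 2 - 2 * x₁)
            rw [← heq.1]
            push_cast at h4
            linarith
        · rw [e, neg_add_cancel] at heq
          exact absurd heq.symm (some_ne_zero h)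
      · obtain ⟨s, hs, h', e'⟩ := exists_some_add_some h₁ h₂ hx
        rw [e', some.injEq] at heq
        rw [← heq.1]
        exact (lt_min hX hY).trans_le (min_padicNorm_le_of_add hA hB hC
          (equation_of_nonsingular h₁) (equation_of_nonsingular h₂) hx hs hX hY)

variable {W : WeierstrassCurve ℚ} [W.IsShortNF] {C : ℚ} {hC : 0 ≤ C}
  {hA : padicNorm p W.a₄ ≤ C ^ 2} {hB : padicNorm p W.a₆ ≤ C ^ 3}

lemma some_mem_nearInfinity {x y : ℚ} {h : W.toAffine.Nonsingular x y} :
    some x y h ∈ nearInfinity W p C hC hA hB ↔ C < padicNorm p x := by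
  refine ⟨fun hP => hP x y h rfl, fun hx x' y' h' e => ?_⟩
  rw [some.injEq] at e
  rwa [← e.1]

end WeierstrassCurve.Affine.Point

/-! ### The curve, and the absence of `2`-torsion -/

open WeierstrassCurve.Affine.Point

instance curveE'_isShortNF (a b : ℤ) : (curveE' a b).IsShortNF where
  a₁ := rfl
  a₂ := rfl
  a₃ := rfl

lemma curveE'_isElliptic {a b : ℤ} (ha : 0 < a) (hab : a < b) : (curveE' a b).IsElliptic := by
  rw [WeierstrassCurve.isElliptic_iff, isUnit_iff_ne_zero]
  have h : a ^ 6 < b ^ 12 := by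
    calc a ^ 6 < b ^ 6 := pow_lt_pow_left₀ hab ha.le (by norm_num)
      _ ≤ b ^ 12 := pow_le_pow_right₀ (by lia) (by norm_num)
  have h' : (a : ℚ) ^ 6 < (b : ℚ) ^ 12 := by exact_mod_cast h
  have ha' : (0 : ℚ) ≤ (a : ℚ) ^ 6 := by positivity
  have e : (curveE' a b).Δ = 64 * (a : ℚ) ^ 6 - 432 * (b : ℚ) ^ 12 := by
    simp only [WeierstrassCurve.Δ, WeierstrassCurve.b₂, WeierstrassCurve.b₄, WeierstrassCurve.b₆,
      WeierstrassCurve.b₈, curveE']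
    ring
  rw [e]
  linarith

lemma curveE'_nonsingular {a b : ℤ} [(curveE' a b).IsElliptic] {x y : ℚ}
    (h : y ^ 2 = x ^ 3 - (a : ℚ) ^ 2 * x + (b : ℚ) ^ 6) :
    (curveE' a b).toAffine.Nonsingular x y := by
  rw [← WeierstrassCurve.Affine.equation_iff_nonsingular, WeierstrassCurve.Affine.equation_iff]
  simp only [curveE']
  linarith

/-- A root of `x³ - a²x + b⁶` would be an integer, and no integer fits: for `0 < a < b` the only
real root lies strictly between `-(b² + 1)` and `-b²`. -/
lemma cubic_ne_zero {a b : ℤ} (ha : 0 < a) (hab : a < b) (x : ℚ) :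
    x ^ 3 - (a : ℚ) ^ 2 * x + (b : ℚ) ^ 6 ≠ 0 := by
  intro hx
  obtain ⟨n, rfl⟩ : ∃ n : ℤ, (n : ℚ) = x := by
    have hint : IsIntegral ℤ x := by
      refine ⟨Polynomial.X ^ 3 + (-Polynomial.C (a ^ 2) * Polynomial.X + Polynomial.C (b ^ 6)),
        ?_, ?_⟩
      · refine Polynomial.monic_X_pow_add (n := 3) ?_
        rw [← Polynomial.C_neg]
        exact Polynomial.degree_linear_le.trans_lt (by norm_num)
      · simp only [Polynomial.eval₂_add, Polynomial.eval₂_mul, Polynomial.eval₂_neg,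
          Polynomial.eval₂_pow, Polynomial.eval₂_X, Polynomial.eval₂_C]
        simp only [algebraMap_int_eq, eq_intCast]
        push_cast
        linarith
    exact IsIntegrallyClosed.isIntegral_iff.mp hint
  have hn : n ^ 3 - a ^ 2 * n + b ^ 6 = 0 := by exact_mod_cast hx
  have hb : 0 < b := ha.trans hab
  have hb6 : b ^ 3 < b ^ 6 := pow_lt_pow_right₀ (by lia) (by norm_num)
  have ha2 : a ^ 2 < b ^ 2 := pow_lt_pow_left₀ hab ha.le (by norm_num)
  rcases lt_or_ge 0 n with h | h
  · rcases le_or_gt a n with h' | h'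
    · have : a ^ 2 ≤ n ^ 2 := pow_le_pow_left₀ ha.le h' 2
      have := mul_le_mul_of_nonneg_right this h.le
      have : 0 < b ^ 6 := by positivity
      nlinarith
    · have h1 : a ^ 2 * n ≤ b ^ 2 * b := by gcongr; lia
      have h2 : 0 < n ^ 3 := by positivity
      nlinarith
  · obtain ⟨t, rfl⟩ : ∃ t, n = -t := ⟨-n, by ring⟩
    have ht : t * (t ^ 2 - a ^ 2) = b ^ 6 := by linarith
    have ht0 : 0 ≤ t := by lia
    rcases le_or_gt t (b ^ 2) with h' | h'
    · have h1 : t ^ 3 ≤ (b ^ 2) ^ 3 := pow_le_pow_left₀ ht0 h' 3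
      have h2 : 0 < t := by
        rcases ht0.lt_or_eq with h2 | h2
        · exact h2
        · rw [← h2] at ht
          have : 0 < b ^ 6 := by positivity
          lia
      have : 0 < a ^ 2 * t := by positivity
      nlinarith
    · have h1 : b ^ 2 + 1 ≤ t := h'
      have h2 : (b ^ 2 + 1) ^ 2 - a ^ 2 ≤ t ^ 2 - a ^ 2 := by
        have := pow_le_pow_left₀ (by positivity) h1 2
        lia
      have h3 : b ^ 4 + b ^ 2 + 1 ≤ (b ^ 2 + 1) ^ 2 - a ^ 2 := by nlinarith
      have h4 : (b ^ 2 + 1) * (b ^ 4 + b ^ 2 + 1) ≤ t * (t ^ 2 - a ^ 2) :=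
        mul_le_mul h1 (h3.trans h2) (by positivity) ht0
      have : 0 < b ^ 4 := by positivity
      nlinarith

lemma curveE'_eq_zero_of_add_self {a b : ℤ} (ha : 0 < a) (hab : a < b)
    (T : (curveE' a b).toAffine.Point) (hT : T + T = 0) : T = 0 := by
  rcases T with (_ | ⟨x, y, h⟩)
  · rfl
  · by_cases hy : y = 0
    · have := equation_of_nonsingular h
      rw [hy] at this
      refine absurd ?_ (cubic_ne_zero ha hab x)
      simp only [curveE'] at this
      linarith
    · obtain ⟨s, -, h', e⟩ := exists_some_add_self h hy
      exact absurd (e.symm.trans hT) (some_ne_zero h')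

/-! ### Lemmas on `p`-adic sizes of rational numbers -/

/-- A prime at which `a / b²` is not integral. -/
lemma exists_prime_padicNorm_sq_lt {a b : ℤ} (h : ¬ b ^ 2 ∣ a) :
    ∃ p : ℕ, ∃ _ : Fact p.Prime, padicNorm p b ^ 2 < padicNorm p a := by
  by_contra! H
  refine h ?_
  rw [← Int.natAbs_dvd_natAbs, Nat.dvd_iff_prime_pow_dvd_dvd]
  intro p k hp hk
  have : Fact p.Prime := ⟨hp⟩
  have h1 : ((p ^ k : ℕ) : ℤ) ∣ b ^ 2 := Int.natCast_dvd.mpr hk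
  rw [padicNorm.dvd_iff_norm_le] at h1
  rw [← Int.natCast_dvd, padicNorm.dvd_iff_norm_le]
  refine (H p this).trans ?_
  rwa [Int.cast_pow, padicNorm.pow] at h1

lemma padicNorm_two_add_one_lt {t : ℚ} (ht : padicNorm 2 t = 1) : padicNorm 2 (t + 1) < 1 := by
  have hd : (t.den : ℚ) ≠ 0 := by exact_mod_cast t.den_ne_zero
  have e : t * ((t.den : ℤ) : ℚ) = t.num := by exact_mod_cast Rat.mul_den_eq_num t
  have hnd : padicNorm 2 (t.den : ℤ) = padicNorm 2 t.num := by
    rw [← e, padicNorm.mul, ht, one_mul]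
  -- numerator and denominator have the same parity, hence are both odd
  have hiff : (2 : ℤ) ∣ t.den ↔ (2 : ℤ) ∣ t.num := by
    have h1 := padicNorm.int_lt_one_iff (p := 2) t.den
    have h2 := padicNorm.int_lt_one_iff (p := 2) t.num
    rw [hnd] at h1
    exact_mod_cast h1.symm.trans h2
  have hodd : ¬ (2 : ℤ) ∣ t.den := fun h => by
    have hcop := t.reduced
    have h1 : 2 ∣ t.num.natAbs := Int.natCast_dvd.mp (hiff.mp h)
    have h2 : 2 ∣ t.den := by exact_mod_cast h
    exact absurd (Nat.eq_one_of_dvd_coprimes hcop h1 h2) (by norm_num)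
  have hnum : ¬ (2 : ℤ) ∣ t.num := fun h => hodd (hiff.mpr h)
  have h1 : padicNorm 2 (t.den : ℤ) = 1 := by
    rw [padicNorm.int_eq_one_iff]; exact_mod_cast hodd
  have h2 : padicNorm 2 ((t.num + t.den : ℤ) : ℚ) < 1 := by
    rw [padicNorm.int_lt_one_iff]; push_cast; omega
  have h3 : (t + 1) * ((t.den : ℤ) : ℚ) = ((t.num + t.den : ℤ) : ℚ) := by
    push_cast at e ⊢
    rw [add_mul, e, one_mul]
  rw [← h3, padicNorm.mul, h1, mul_one] at h2
  exact h2

lemma padicNorm_two_le_half {t : ℚ} (ht : padicNorm 2 t < 1) : padicNorm 2 t ≤ 1 / 2 := by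
  by_cases h0 : t = 0
  · simp [h0]
  obtain ⟨z, hz⟩ := padicNorm.values_discrete (p := 2) h0
  rw [hz] at ht ⊢
  push_cast at ht ⊢
  have : -z < 0 := by
    by_contra! h
    exact absurd (one_le_zpow₀ (by norm_num : (1 : ℚ) ≤ 2) h) (not_le.mpr ht)
  calc (2 : ℚ) ^ (-z) ≤ 2 ^ (-1 : ℤ) := zpow_le_zpow_right₀ (by norm_num) (by lia)
    _ = 1 / 2 := by norm_num

/-- The denominator `4t(t² - 1)` is `2`-adically smaller than the numerator `(t + 1)⁴ - 12t²`
for every rational `t`. -/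
lemma one_lt_padicNorm_two {τ t : ℚ} (h : τ * (4 * t * (t ^ 2 - 1)) = -((t + 1) ^ 4 - 12 * t ^ 2)) :
    1 < padicNorm 2 τ := by
  have n2 : padicNorm 2 2 = 1 / 2 := by
    have := padicNorm.padicNorm_p_of_prime (p := 2)
    push_cast at this
    rw [this]; norm_num
  have n4 : padicNorm 2 4 = 1 / 4 := by
    rw [show (4 : ℚ) = 2 * 2 by norm_num, padicNorm.mul, n2]; norm_num
  have n12 : padicNorm 2 12 = 1 / 4 := by
    have h3 : padicNorm 2 ((3 : ℕ) : ℚ) = 1 := (padicNorm.nat_eq_one_iff 3).mpr (by norm_num)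
    push_cast at h3
    rw [show (12 : ℚ) = 4 * 3 by norm_num, padicNorm.mul, n4, h3]; norm_num
  have hN := congrArg (padicNorm 2) h
  rw [padicNorm.neg, sub_eq_add_neg ((t + 1) ^ 4), padicNorm.mul, padicNorm.mul, padicNorm.mul,
    n4] at hN
  have h12 : padicNorm 2 (-(12 * t ^ 2)) = 1 / 4 * padicNorm 2 t ^ 2 := by
    rw [padicNorm.neg, padicNorm.mul, n12, padicNorm.pow]
  by_contra! hτ
  have hτ0 := padicNorm.nonneg (p := 2) τ
  have ht0 := padicNorm.nonneg (p := 2) t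
  have hq0 := padicNorm.nonneg (p := 2) (t ^ 2 - 1)
  rcases lt_trichotomy (padicNorm 2 t) 1 with ht | ht | ht
  · have h1 : padicNorm 2 (t + 1) = 1 := by
      rw [add_comm, padicNorm.add_eq_left_of_lt] <;> simp [ht]
    have h2 : padicNorm 2 (t ^ 2 - 1) ≤ 1 :=
      padicNorm.sub.trans (max_le (by rw [padicNorm.pow]; exact pow_le_one₀ ht0 ht.le) (by simp))
    have h3 : padicNorm 2 ((t + 1) ^ 4 + -(12 * t ^ 2)) = 1 := by
      have h4 : padicNorm 2 ((t + 1) ^ 4) = 1 := by rw [padicNorm.pow, h1, one_pow]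
      rw [padicNorm.add_eq_left_of_lt, h4]
      rw [h4, h12]
      nlinarith
    rw [h3] at hN
    have h5 : padicNorm 2 t * padicNorm 2 (t ^ 2 - 1) ≤ 1 := mul_le_one₀ ht.le hq0 h2
    nlinarith [mul_le_one₀ hτ (mul_nonneg ht0 hq0) h5]
  · have h1 := padicNorm_two_le_half (padicNorm_two_add_one_lt ht)
    have h2 : padicNorm 2 (t - 1) ≤ 1 / 2 := by
      rw [show t - 1 = (t + 1) + -2 by ring]
      exact padicNorm.add_le_of_le h1 (by rw [padicNorm.neg, n2])
    have h3 : padicNorm 2 (t ^ 2 - 1) ≤ 1 / 4 := by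
      rw [show t ^ 2 - 1 = (t + 1) * (t - 1) by ring, padicNorm.mul]
      calc _ ≤ (1 / 2 : ℚ) * (1 / 2) := mul_le_mul h1 h2 (padicNorm.nonneg _) (by norm_num)
        _ = 1 / 4 := by norm_num
    have h4 : padicNorm 2 ((t + 1) ^ 4 + -(12 * t ^ 2)) = 1 / 4 := by
      rw [add_comm, padicNorm.add_eq_left_of_lt, h12, ht]
      · norm_num
      · rw [h12, ht, padicNorm.pow]
        calc _ ≤ (1 / 2 : ℚ) ^ 4 := pow_le_pow_left₀ (padicNorm.nonneg _) h1 4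
          _ < _ := by norm_num
    rw [h4, ht] at hN
    nlinarith [mul_le_one₀ hτ hq0 (h3.trans (by norm_num))]
  · have h1 : padicNorm 2 (t + 1) = padicNorm 2 t := padicNorm.add_eq_left_of_lt (by simpa)
    have h2 : padicNorm 2 (t ^ 2 - 1) = padicNorm 2 t ^ 2 := by
      rw [sub_eq_add_neg, padicNorm.add_eq_left_of_lt, padicNorm.pow]
      rw [padicNorm.pow, padicNorm.neg, padicNorm.one]
      exact one_lt_pow₀ ht (by norm_num)
    have h3 : padicNorm 2 ((t + 1) ^ 4 + -(12 * t ^ 2)) = padicNorm 2 t ^ 4 := by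
      rw [padicNorm.add_eq_left_of_lt, padicNorm.pow, h1]
      rw [h12, padicNorm.pow, h1]
      nlinarith [one_lt_pow₀ ht (two_ne_zero)]
    rw [h3, h2] at hN
    have h4 : 0 < padicNorm 2 t ^ 3 := by positivity
    nlinarith [mul_le_mul_of_nonneg_right hτ h4.le, mul_lt_mul_of_pos_right ht h4]

/-! ### A criterion for independence -/

/-- Divisibility by two of every relation, together with the absence of `2`-torsion, gives
independence by infinite descent. -/
lemma linearIndependent_of_even_relations {G : Type*} [AddCommGroup G] {v : Fin 3 → G}
    (htor : ∀ T : G, T + T = 0 → T = 0)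
    (heven : ∀ g : Fin 3 → ℤ, ∑ i, g i • v i = 0 → ∀ i, 2 ∣ g i) :
    LinearIndependent ℤ v := by
  rw [Fintype.linearIndependent_iff]
  have key : ∀ k : ℕ, ∀ g : Fin 3 → ℤ, ∑ i, g i • v i = 0 → ∀ i, 2 ^ k ∣ g i := by
    intro k
    induction k with
    | zero => simp
    | succ k ih =>
      intro g hg i
      choose f hf using heven g hg
      have : ∑ i, f i • v i = 0 := by
        refine htor _ ?_
        rw [← Finset.sum_add_distrib, ← hg]
        refine Finset.sum_congr rfl fun i _ => ?_
        rw [hf i, two_mul, add_smul]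
      rw [hf i, pow_succ']
      exact mul_dvd_mul_left 2 (ih f this i)
  intro g hg i
  by_contra h0
  obtain ⟨k, hk⟩ := (Int.finiteMultiplicity_iff (a := 2) (b := g i)).mpr ⟨by norm_num, h0⟩
  exact hk (key _ g hg i)

/-! ### Halving `P - R` -/

/-- `P - R` for `P = (0, b³)`, `R = (-b², ab)`; here `s = b + a / b` is the slope of the line
through `P` and `-R`. -/
lemma exists_sub_eq_some {a b : ℤ} (hb : b ≠ 0)
    (h₁ : (curveE' a b).toAffine.Nonsingular 0 ((b : ℚ) ^ 3))
    (h₃ : (curveE' a b).toAffine.Nonsingular (-(b : ℚ) ^ 2) ((a : ℚ) * (b : ℚ))) :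
    ∃ s : ℚ, s * b = b ^ 2 + a ∧
      ∃ h : (curveE' a b).toAffine.Nonsingular (s ^ 2 + b ^ 2) (-(s * (s ^ 2 + b ^ 2) + b ^ 3)),
        some _ _ h₁ - some _ _ h₃ = some _ _ h := by
  have hb' : (b : ℚ) ≠ 0 := by exact_mod_cast hb
  obtain ⟨h₃', e₃⟩ := some_neg h₃
  obtain ⟨s, hs, h, e⟩ := exists_some_add_some h₁ h₃'
    (by simpa using hb)
  have ex : s ^ 2 - 0 - -(b : ℚ) ^ 2 = s ^ 2 + b ^ 2 := by ring
  have ey : s * (2 * 0 + -(b : ℚ) ^ 2 - s ^ 2) - b ^ 3 = -(s * (s ^ 2 + b ^ 2) + b ^ 3) := by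
    ring
  rw [sub_eq_add_neg, e₃, e]
  rw [ex, ey] at h
  refine ⟨s, mul_right_cancel₀ hb' (by linear_combination hs), h, ?_⟩
  rw [some.injEq]
  exact ⟨ex, ey⟩

/-- If `P - R = 2T`, let `s` be the slope of the line through `P` and `-R` and `w` that of the
tangent at `T`. Then `t = (w - s) / b` satisfies `τ · 4t(t² - 1) = -((t + 1)⁴ - 12t²)` for
`τ = a / b²`, so that `τ` has even denominator. -/
lemma one_lt_padicNorm_two_of_sub_eq_add_self {a b : ℤ} (hb : b ≠ 0)
    (h₁ : (curveE' a b).toAffine.Nonsingular 0 ((b : ℚ) ^ 3))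
    (h₃ : (curveE' a b).toAffine.Nonsingular (-(b : ℚ) ^ 2) ((a : ℚ) * (b : ℚ)))
    (T : (curveE' a b).toAffine.Point) (hT : some _ _ h₁ - some _ _ h₃ = T + T) :
    1 < padicNorm 2 ((a : ℚ) / (b : ℚ) ^ 2) := by
  have hb' : (b : ℚ) ≠ 0 := by exact_mod_cast hb
  obtain ⟨s, hs, h, e⟩ := exists_sub_eq_some hb h₁ h₃
  rw [e] at hT
  rcases T with (_ | ⟨x, y, hxy⟩)
  · exact absurd (hT.trans (add_zero _)) (some_ne_zero h)
  by_cases hy : y = 0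
  · rw [some_add_self_of_y_eq_zero hxy hy] at hT
    exact absurd hT (some_ne_zero h)
  obtain ⟨w, hw, h', e'⟩ := exists_some_add_self hxy hy
  rw [e', some.injEq] at hT
  obtain ⟨hX, hY⟩ := hT
  have hA : (curveE' a b).a₄ = -(a : ℚ) ^ 2 := rfl
  rw [hA] at hw
  have ha : (a : ℚ) = b * (s - b) := by linarith
  have hx : x = (w ^ 2 - s ^ 2 - b ^ 2) / 2 := by linarith
  have hy : y = w * (3 * x - w ^ 2) + s * (s ^ 2 + b ^ 2) + b ^ 3 := by linarith
  obtain ⟨t, ht⟩ : ∃ t : ℚ, t * b = w - s := ⟨_, div_mul_cancel₀ _ hb'⟩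
  obtain ⟨τ, hτ⟩ : ∃ τ : ℚ, τ * b = s - b := ⟨_, div_mul_cancel₀ _ hb'⟩
  have hs' : s = b * (1 + τ) := by linarith
  have hw' : w = b * (1 + τ + t) := by linarith
  have haτ : (a : ℚ) / (b : ℚ) ^ 2 = τ := by
    rw [div_eq_iff (pow_ne_zero 2 hb'), ha, hs']; ring
  rw [haτ]
  refine one_lt_padicNorm_two (t := t) (mul_left_cancel₀ (pow_ne_zero 4 hb') ?_)
  rw [ha, hy, hx, hs', hw'] at hw
  linear_combination 4 * hw

/-! ### Sizes of the `x`-coordinates of `P - R`, `2P` and `2Q` -/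

section Valuations

variable {a b : ℤ} {p : ℕ} [Fact p.Prime]

/-- The threshold `|a / b|ₚ²` is the size of `x(P - R)`. -/
lemma padicNorm_le_div (h : padicNorm p b ^ 2 < padicNorm p a) (hb : b ≠ 0) :
    padicNorm p a < (padicNorm p a / padicNorm p b) ^ 2 := by
  have hβ : 0 < padicNorm p b := lt_of_le_of_ne (padicNorm.nonneg _)
    (padicNorm.nonzero (by exact_mod_cast hb)).symm
  have hα : 0 < padicNorm p a := (sq_nonneg _).trans_lt h
  rw [div_pow, lt_div_iff₀ (by positivity), sq (padicNorm p a)]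
  exact mul_lt_mul_of_pos_left h hα

lemma padicNorm_a₄_le {C : ℚ} (hC : padicNorm p a ≤ C) :
    padicNorm p (curveE' a b).a₄ ≤ C ^ 2 := by
  have : (curveE' a b).a₄ = -(a : ℚ) ^ 2 := rfl
  rw [this, padicNorm.neg, padicNorm.pow]
  exact pow_le_pow_left₀ (padicNorm.nonneg _) hC 2

lemma padicNorm_a₆_le {C : ℚ} (h : padicNorm p b ^ 2 < padicNorm p a) (hC : padicNorm p a ≤ C) :
    padicNorm p (curveE' a b).a₆ ≤ C ^ 3 := by
  have : (curveE' a b).a₆ = (b : ℚ) ^ 6 := rfl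
  rw [this, padicNorm.pow, show padicNorm p b ^ 6 = (padicNorm p b ^ 2) ^ 3 by ring]
  exact pow_le_pow_left₀ (sq_nonneg _) (h.le.trans hC) 3

/-- `x(P - R) = a² / b² + 2a + 2b²`, and the first term dominates. -/
lemma padicNorm_sub (h : padicNorm p b ^ 2 < padicNorm p a) (hb : b ≠ 0) {s : ℚ}
    (hs : s * b = b ^ 2 + a) :
    padicNorm p (s ^ 2 + b ^ 2) = (padicNorm p a / padicNorm p b) ^ 2 := by
  have hb' : (b : ℚ) ≠ 0 := by exact_mod_cast hb
  have e : s ^ 2 + b ^ 2 = ((a : ℚ) / b) ^ 2 + ((2 : ℤ) * (a : ℚ) + (2 : ℤ) * (b : ℚ) ^ 2) := by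
    rw [eq_div_of_mul_eq hb' hs]; field_simp; push_cast; ring
  have hlt := padicNorm_le_div h hb
  rw [e, padicNorm.add_eq_left_of_lt, padicNorm.pow, padicNorm.div]
  rw [padicNorm.pow, padicNorm.div]
  refine padicNorm.add_lt_of_lt ((padicNorm.intCast_mul_le _ _).trans_lt hlt)
    ((padicNorm.intCast_mul_le _ _).trans_lt ?_)
  rw [padicNorm.pow]
  exact h.trans hlt

lemma lt_padicNorm_a_div (h : padicNorm p b ^ 2 < padicNorm p a) (hb : b ≠ 0) :
    (padicNorm p a / padicNorm p b) ^ 2 < padicNorm p ((a : ℚ) ^ 4 / (b : ℚ) ^ 6) := by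
  have hβ : 0 < padicNorm p b := lt_of_le_of_ne (padicNorm.nonneg _)
    (padicNorm.nonzero (by exact_mod_cast hb)).symm
  have hα : 0 < padicNorm p a := (sq_nonneg _).trans_lt h
  rw [padicNorm.div, padicNorm.pow, padicNorm.pow, div_pow,
    div_lt_div_iff₀ (by positivity) (by positivity)]
  have h2 : (padicNorm p b ^ 2) ^ 2 < padicNorm p a ^ 2 :=
    pow_lt_pow_left₀ h (sq_nonneg _) (by norm_num)
  calc padicNorm p a ^ 2 * padicNorm p b ^ 6
      = padicNorm p a ^ 2 * padicNorm p b ^ 2 * (padicNorm p b ^ 2) ^ 2 := by ring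
    _ < padicNorm p a ^ 2 * padicNorm p b ^ 2 * padicNorm p a ^ 2 :=
        mul_lt_mul_of_pos_left h2 (by positivity)
    _ = _ := by ring

variable {C : ℚ} {hC : 0 ≤ C} {hA : padicNorm p (curveE' a b).a₄ ≤ C ^ 2}
  {hB : padicNorm p (curveE' a b).a₆ ≤ C ^ 3}

lemma two_nsmul_mem_of_x_eq_zero (h : padicNorm p b ^ 2 < padicNorm p a) (hb : b ≠ 0)
    (hle : C ≤ (padicNorm p a / padicNorm p b) ^ 2)
    (h₁ : (curveE' a b).toAffine.Nonsingular 0 ((b : ℚ) ^ 3)) :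
    some _ _ h₁ + some _ _ h₁ ∈ nearInfinity (curveE' a b) p C hC hA hB := by
  have hb' : (b : ℚ) ≠ 0 := by exact_mod_cast hb
  obtain ⟨s, hs, h', e⟩ := exists_some_add_self h₁ (pow_ne_zero 3 hb')
  rw [e, some_mem_nearInfinity]
  refine hle.trans_lt ((lt_padicNorm_a_div h hb).trans_le ?_)
  have hA : (curveE' a b).a₄ = -(a : ℚ) ^ 2 := rfl
  have ex : (a : ℚ) ^ 4 / b ^ 6 = (4 : ℤ) * (s ^ 2 - 2 * 0) := by
    rw [div_eq_iff (pow_ne_zero 6 hb')]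
    rw [hA] at hs
    push_cast
    linear_combination (-s * 2 * b ^ 3 + a ^ 2) * hs
  rw [ex]
  exact padicNorm.intCast_mul_le _ _

lemma two_nsmul_mem_of_x_eq_a (h : padicNorm p b ^ 2 < padicNorm p a) (hb : b ≠ 0)
    (hle : C ≤ (padicNorm p a / padicNorm p b) ^ 2)
    (h₂ : (curveE' a b).toAffine.Nonsingular (a : ℚ) ((b : ℚ) ^ 3)) :
    some _ _ h₂ + some _ _ h₂ ∈ nearInfinity (curveE' a b) p C hC hA hB := by
  have hb' : (b : ℚ) ≠ 0 := by exact_mod_cast hb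
  obtain ⟨s, hs, h', e⟩ := exists_some_add_self h₂ (pow_ne_zero 3 hb')
  rw [e, some_mem_nearInfinity]
  have hA : (curveE' a b).a₄ = -(a : ℚ) ^ 2 := rfl
  have hs' : s * b ^ 3 = a ^ 2 := by rw [hA] at hs; linarith
  have ex : s ^ 2 - 2 * (a : ℚ) = (a : ℚ) ^ 4 / b ^ 6 + (-2 : ℤ) * (a : ℚ) := by
    rw [eq_div_of_mul_eq (pow_ne_zero 3 hb') hs']; field_simp; push_cast; ring
  rw [ex, padicNorm.add_eq_left_of_lt]
  · exact hle.trans_lt (lt_padicNorm_a_div h hb)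
  · exact (padicNorm.intCast_mul_le _ _).trans_lt
      ((padicNorm_le_div h hb).trans (lt_padicNorm_a_div h hb))

end Valuations

/-! ### Relations between `P`, `Q` and `R` -/

section Relations

variable {a b : ℤ} {h₁ : (curveE' a b).toAffine.Nonsingular 0 ((b : ℚ) ^ 3)}
  {h₂ : (curveE' a b).toAffine.Nonsingular (a : ℚ) ((b : ℚ) ^ 3)}
  {h₃ : (curveE' a b).toAffine.Nonsingular (-(b : ℚ) ^ 2) ((a : ℚ) * (b : ℚ))}

/-- `P + Q = (-a, -b³)`. -/
lemma exists_add_eq_some (ha : a ≠ 0) :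
    ∃ y, ∃ h : (curveE' a b).toAffine.Nonsingular (-(a : ℚ)) y,
      some _ _ h₁ + some _ _ h₂ = some _ _ h := by
  have ha' : (a : ℚ) ≠ 0 := by exact_mod_cast ha
  obtain ⟨s, hs, h, e⟩ := exists_some_add_some h₁ h₂ ha'.symm
  have hs0 : s = 0 := by simpa [ha'] using hs
  have ex : s ^ 2 - 0 - (a : ℚ) = -a := by rw [hs0]; ring
  rw [e]
  exact ⟨_, ex ▸ h, by rw [some.injEq]; exact ⟨ex, rfl⟩⟩

/-- Modulo the points near infinity at a prime where `a / b²` is not integral, `P` and `R` agree,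
and `P`, `Q` generate a Klein four-group. -/
lemma even_and_even_of_relation (ha : a ≠ 0) (hb : b ≠ 0) (hdvd : ¬ b ^ 2 ∣ a) {n m l : ℤ}
    (hrel : n • some _ _ h₁ + m • some _ _ h₂ + l • some _ _ h₃ = 0) :
    Even (n + l) ∧ Even m := by
  obtain ⟨p, _, hp⟩ := exists_prime_padicNorm_sq_lt hdvd
  have hle := padicNorm_le_div hp hb
  set H := nearInfinity (curveE' a b) p (padicNorm p a) (padicNorm.nonneg _)
    (padicNorm_a₄_le le_rfl) (padicNorm_a₆_le hp le_rfl) with hH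
  have hP2 : some _ _ h₁ + some _ _ h₁ ∈ H := two_nsmul_mem_of_x_eq_zero hp hb hle.le h₁
  have hQ2 : some _ _ h₂ + some _ _ h₂ ∈ H := two_nsmul_mem_of_x_eq_a hp hb hle.le h₂
  have hPR : some _ _ h₁ - some _ _ h₃ ∈ H := by
    obtain ⟨s, hs, h, e⟩ := exists_sub_eq_some hb h₁ h₃
    rw [e, hH, some_mem_nearInfinity, padicNorm_sub hp hb hs]
    exact hle
  have hP : some _ _ h₁ ∉ H := by
    rw [hH, some_mem_nearInfinity, padicNorm.zero]
    exact not_lt.mpr (padicNorm.nonneg _)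
  have hQ : some _ _ h₂ ∉ H := by
    rw [hH, some_mem_nearInfinity]
    exact lt_irrefl _
  have hPQ : some _ _ h₁ + some _ _ h₂ ∉ H := by
    obtain ⟨y, h, e⟩ := exists_add_eq_some (h₁ := h₁) (h₂ := h₂) ha
    rw [e, hH, some_mem_nearInfinity, padicNorm.neg]
    exact lt_irrefl _
  generalize some _ _ h₁ = P at *
  generalize some _ _ h₂ = Q at *
  generalize some _ _ h₃ = R at *
  have hmem : (n + l) • P + m • Q ∈ H := by
    have : (n + l) • P + m • Q = l • (P - R) + (n • P + m • Q + l • R) := by module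
    rw [this, hrel, add_zero]
    exact H.zsmul_mem hPR l
  rcases Int.even_or_odd' (n + l) with ⟨i, hi | hi⟩ <;>
    rcases Int.even_or_odd' m with ⟨j, hj | hj⟩ <;> rw [hi, hj] at hmem
  · exact ⟨⟨i, by lia⟩, ⟨j, by lia⟩⟩
  · refine absurd ?_ hQ
    have : Q = ((2 * i) • P + (2 * j + 1) • Q) - i • (P + P) - j • (Q + Q) := by module
    rw [this]
    exact H.sub_mem (H.sub_mem hmem (H.zsmul_mem hP2 i)) (H.zsmul_mem hQ2 j)
  · refine absurd ?_ hP
    have : P = ((2 * i + 1) • P + (2 * j) • Q) - i • (P + P) - j • (Q + Q) := by module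
    rw [this]
    exact H.sub_mem (H.sub_mem hmem (H.zsmul_mem hP2 i)) (H.zsmul_mem hQ2 j)
  · refine absurd ?_ hPQ
    have : P + Q = ((2 * i + 1) • P + (2 * j + 1) • Q) - i • (P + P) - j • (Q + Q) := by module
    rw [this]
    exact H.sub_mem (H.sub_mem hmem (H.zsmul_mem hP2 i)) (H.zsmul_mem hQ2 j)

/-- `P - R` is never congruent to zero modulo `⟨2P, 2Q, 2(P - R)⟩`. If it were, then `a / b²`
would have even denominator, and at the prime two the subgroup `|x|₂ > |x(P - R)|₂` would contain
the three doubles but not `P - R`. -/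
lemma sub_ne_double (hb : b ≠ 0) (i j k : ℤ) :
    some _ _ h₁ - some _ _ h₃ ≠ i • (some _ _ h₁ + some _ _ h₁) +
      j • (some _ _ h₂ + some _ _ h₂) +
      k • ((some _ _ h₁ - some _ _ h₃) + (some _ _ h₁ - some _ _ h₃)) := by
  intro heq
  have hb' : (b : ℚ) ≠ 0 := by exact_mod_cast hb
  have hp : padicNorm 2 b ^ 2 < padicNorm 2 a := by
    have := one_lt_padicNorm_two_of_sub_eq_add_self hb h₁ h₃
      (i • some _ _ h₁ + j • some _ _ h₂ + k • (some _ _ h₁ - some _ _ h₃))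
      (heq.trans (by module))
    have hβ : 0 < padicNorm 2 b := lt_of_le_of_ne (padicNorm.nonneg _) (padicNorm.nonzero hb').symm
    rwa [padicNorm.div, padicNorm.pow, one_lt_div (by positivity)] at this
  have hle := padicNorm_le_div hp hb
  set H := nearInfinity (curveE' a b) 2 ((padicNorm 2 a / padicNorm 2 b) ^ 2) (sq_nonneg _)
    (padicNorm_a₄_le hle.le) (padicNorm_a₆_le hp hle.le) with hH
  obtain ⟨s, hs, h, e⟩ := exists_sub_eq_some hb h₁ h₃
  have hx := padicNorm_sub hp hb hs
  have hD : some _ _ h ∉ H := by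
    rw [hH, some_mem_nearInfinity, hx]
    exact lt_irrefl _
  have hD2 : some _ _ h + some _ _ h ∈ H := by
    by_cases hy : -(s * (s ^ 2 + (b : ℚ) ^ 2) + b ^ 3) = 0
    · rw [some_add_self_of_y_eq_zero h hy]
      exact H.zero_mem
    obtain ⟨w, hw, h', e'⟩ := exists_some_add_self h hy
    rw [e', hH, some_mem_nearInfinity]
    have h4 := padicNorm_four_mul_of_add_self (p := 2) (padicNorm_a₄_le le_rfl)
      (padicNorm_a₆_le hp le_rfl) (padicNorm.nonneg _) (equation_of_nonsingular h) hw
      (by rw [hx]; exact hle)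
    have h4' : padicNorm 2 4 < 1 := by
      exact_mod_cast (padicNorm.int_lt_one_iff (p := 2) 4).mpr (by norm_num)
    rw [padicNorm.mul, hx] at h4
    have hpos : 0 < (padicNorm 2 a / padicNorm 2 b) ^ 2 := (padicNorm.nonneg _).trans_lt hle
    have h40 := padicNorm.nonneg (p := 2) 4
    by_contra! hcon
    nlinarith [mul_le_mul_of_nonneg_left hcon h40]
  refine hD ?_
  rw [← e, heq, e]
  exact H.add_mem (H.add_mem
    (H.zsmul_mem (two_nsmul_mem_of_x_eq_zero hp hb le_rfl h₁) i)
    (H.zsmul_mem (two_nsmul_mem_of_x_eq_a hp hb le_rfl h₂) j)) (H.zsmul_mem hD2 k)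

lemma even_of_relation (ha : a ≠ 0) (hb : b ≠ 0) (hdvd : ¬ b ^ 2 ∣ a) {n m l : ℤ}
    (hrel : n • some _ _ h₁ + m • some _ _ h₂ + l • some _ _ h₃ = 0) :
    2 ∣ n ∧ 2 ∣ m ∧ 2 ∣ l := by
  obtain ⟨⟨i, hi⟩, ⟨j, hj⟩⟩ := even_and_even_of_relation ha hb hdvd hrel
  rcases Int.even_or_odd' l with ⟨k, hk | hk⟩
  · exact ⟨⟨i - k, by lia⟩, ⟨j, by lia⟩, ⟨k, hk⟩⟩
  · -- here `l(P - R) = 2(iP + jQ)` with `l = 2k + 1`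
    refine absurd ?_ (sub_ne_double (h₁ := h₁) (h₂ := h₂) (h₃ := h₃) hb i j (-k))
    obtain rfl : n = 2 * i - (2 * k + 1) := by lia
    subst hk
    obtain rfl : m = 2 * j := by lia
    rw [← sub_eq_zero, ← neg_eq_zero, ← hrel]
    module

end Relations

theorem theorem1p3 (a b : ℤ) (ha : 0 < a) (hab : a < b) :
    (curveE' a b).IsElliptic ∧
    3 ≤ mordellWeilRank (curveE' a b) ∧
    ∃ (h₁ : (curveE' a b).toAffine.Nonsingular 0 ((b : ℚ) ^ 3))
      (h₂ : (curveE' a b).toAffine.Nonsingular (a : ℚ) ((b : ℚ) ^ 3))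
      (h₃ : (curveE' a b).toAffine.Nonsingular (-(b : ℚ) ^ 2) ((a : ℚ) * (b : ℚ))),
      LinearIndependent ℤ
        (![WeierstrassCurve.Affine.Point.some _ _ h₁,
           WeierstrassCurve.Affine.Point.some _ _ h₂,
           WeierstrassCurve.Affine.Point.some _ _ h₃] :
          Fin 3 → (curveE' a b).toAffine.Point) := by
  have hE := curveE'_isElliptic ha hab
  have hb : 0 < b := ha.trans hab
  have hdvd : ¬ b ^ 2 ∣ a := fun h => by
    have := Int.le_of_dvd ha h
    nlinarith
  have h₁ : (curveE' a b).toAffine.Nonsingular 0 ((b : ℚ) ^ 3) := curveE'_nonsingular (by ring)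
  have h₂ : (curveE' a b).toAffine.Nonsingular (a : ℚ) ((b : ℚ) ^ 3) :=
    curveE'_nonsingular (by ring)
  have h₃ : (curveE' a b).toAffine.Nonsingular (-(b : ℚ) ^ 2) ((a : ℚ) * (b : ℚ)) :=
    curveE'_nonsingular (by ring)
  have hli : LinearIndependent ℤ (![some _ _ h₁, some _ _ h₂, some _ _ h₃] :
      Fin 3 → (curveE' a b).toAffine.Point) := by
    refine linearIndependent_of_even_relations (curveE'_eq_zero_of_add_self ha hab) ?_
    intro g hg
    rw [Fin.sum_univ_three] at hg
    obtain ⟨d₀, d₁, d₂⟩ := even_of_relation ha.ne' hb.ne' hdvd hg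
    intro i
    fin_cases i
    exacts [d₀, d₁, d₂]
  refine ⟨hE, ?_, h₁, h₂, h₃, hli⟩
  simpa [mordellWeilRank] using hli.cardinal_le_rank
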